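/- Let $p$ be a prime, let $\nu_p$ denote the $p$-adic valuation, and for $l\in\mathbb Z$ let the higher order Bernoulli polynomials $B_m^{(l)}(x)\in\mathbb Q[x]$ be defined by $$\left(\frac{t}{e^t-1}\right)^{l}e^{tx}=\sum_{m\ge 0}B_m^{(l)}(x)\frac{t^m}{m!}.$$ The maximum pole (at $p$) of a rational polynomial is the exponent of the highest power of $p$ occurring in the denominator of any of its coefficients (in lowest terms). Let $n,k$ be integers with $0\le k\le n$. (a) If $M$ is the maximum pole of $B_{n-k}^{(-k)}(x)$, then the almost minimum zero estimate $\nu_p\left(\binom{n}{k}\right)-M$ for the Stirling number of the second kind $S(n,k)$ is non-negative: $\nu_p\left(\binom nk\right)-M\ge 0$. (b) If moreover $k\ge 1$ and $M'$ is the maximum pole of $B_{n-k}^{(-k+1)}(x)$, then the shifted almost minimum zero estimate $\nu_p\left(\binom{n-1}{k-1}\right)-M'$ for $S(n,k)$ is non-negative: $\nu_p\left(\binom{n-1}{k-1}\right)-M'\ge 0$. -/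

import Mathlib

open scoped Nat

namespace HigherBernoulli

/-- The formal power series `(e^t - 1) / t = ∑ t^n / (n+1)!` over `ℚ`. -/
noncomputable def expSubOneDiv : PowerSeries ℚ :=
  PowerSeries.mk fun n => (1 : ℚ) / ((n + 1)! : ℚ)

/-- `t * ((e^t - 1) / t) = e^t - 1`. -/
theorem X_mul_expSubOneDiv :
    PowerSeries.X * expSubOneDiv = PowerSeries.exp ℚ - 1 := by
  ext n
  cases n with
  | zero => simp
  | succ n => simp [PowerSeries.coeff_succ_X_mul, expSubOneDiv, PowerSeries.coeff_exp,
      PowerSeries.coeff_one]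

theorem constantCoeff_expSubOneDiv_ne_zero :
    PowerSeries.constantCoeff expSubOneDiv ≠ 0 := by
  simp [expSubOneDiv, ← PowerSeries.coeff_zero_eq_constantCoeff_apply]

/-- The series `t / (e^t - 1)`, as a unit of the ring `ℚ⟦t⟧` (so that it has integer powers). -/
noncomputable def tDivExpSubOne : (PowerSeries ℚ)ˣ where
  val := expSubOneDiv⁻¹
  inv := expSubOneDiv
  val_inv := PowerSeries.inv_mul_cancel _ constantCoeff_expSubOneDiv_ne_zero
  inv_val := PowerSeries.mul_inv_cancel _ constantCoeff_expSubOneDiv_ne_zero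

/-- The higher order Bernoulli polynomial `B_n^{(l)}(x)` of order `l ∈ ℤ` and degree `n`, given by
`(t / (e^t - 1))^l * e^{t x} = ∑ B_n^{(l)}(x) t^n / n!`, an identity in `ℚ[x]⟦t⟧`. -/
noncomputable def bernoulliPoly (l : ℤ) (n : ℕ) : Polynomial ℚ :=
  (n ! : ℚ) • PowerSeries.coeff n
    (PowerSeries.map Polynomial.C ((tDivExpSubOne ^ l : (PowerSeries ℚ)ˣ) : PowerSeries ℚ) *
      PowerSeries.rescale (Polynomial.X : Polynomial ℚ) (PowerSeries.exp (Polynomial ℚ)))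

/-- The maximum pole of a rational polynomial at `p`: the exponent of the highest power of `p`
that occurs in the denominator of one of its coefficients (written in lowest terms). -/
noncomputable def maxPole (p : ℕ) (f : Polynomial ℚ) : ℕ :=
  f.support.sup fun i => padicValNat p (f.coeff i).den

/-- The almost minimum zero (AMZ) estimate for `S(n,k)`: the integer
`ν_p (n choose k) - M`, where `M` is the maximum pole of `B_{n-k}^{(-k)}(x)`. -/
noncomputable def amzEstimate (p n k : ℕ) : ℤ :=
  (padicValNat p (n.choose k) : ℤ) - (maxPole p (bernoulliPoly (-(k : ℤ)) (n - k)) : ℤ)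

/-- The shifted almost minimum zero (SAMZ) estimate for `S(n,k)`, `1 ≤ k ≤ n`: the integer
`ν_p (n-1 choose k-1) - M'`, where `M'` is the maximum pole of `B_{n-k}^{(-k+1)}(x)`. -/
noncomputable def samzEstimate (p n k : ℕ) : ℤ :=
  (padicValNat p ((n - 1).choose (k - 1)) : ℤ) -
    (maxPole p (bernoulliPoly (-(k : ℤ) + 1) (n - k)) : ℤ)

end HigherBernoulli

namespace HigherBernoulli

/-! Since `((e^t - 1)/t)^k` generates Stirling numbers up to factorials, `(n choose k)
B_{n-k}^{(-k)}(x)` is the integer polynomial `∑ (n choose i) S(n-i,k) x^i` over `i ≤ n - k`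
(`choose_mul_coeff_bernoulliPoly`). So `n choose k` clears every denominator, and its valuation
bounds the pole. -/

/-- The exponential generating function of the Stirling numbers of the second kind:
`(e^t - 1)^k / k! = ∑ S(n,k) t^n / n!`. -/
theorem factorial_mul_coeff_exp_sub_one_pow (n k : ℕ) :
    (n ! : ℚ) * PowerSeries.coeff n ((PowerSeries.exp ℚ - 1) ^ k) =
      (k ! : ℚ) * (n.stirlingSecond k : ℚ) := by
  induction n generalizing k with
  | zero =>
    cases k with
    | zero => simp
    | succ k => simp
  | succ n ih =>
    cases k with
    | zero => simp [PowerSeries.coeff_one]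
    | succ k =>
      -- With `u = e^t - 1` one has `u' = u + 1`; on coefficients this is the Stirling recurrence.
      have hd : PowerSeries.derivative ℚ ((PowerSeries.exp ℚ - 1) ^ (k + 1)) =
          PowerSeries.C ((k : ℚ) + 1) *
            ((PowerSeries.exp ℚ - 1) ^ k + (PowerSeries.exp ℚ - 1) ^ (k + 1)) := by
        rw [PowerSeries.derivative_pow, map_sub, PowerSeries.derivative_exp,
          PowerSeries.derivative_one]
        simp only [map_add, map_one, map_natCast, Nat.add_sub_cancel]
        push_cast
        ring
      have hc := congrArg (PowerSeries.coeff n) hd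
      rw [PowerSeries.coeff_derivative, PowerSeries.coeff_C_mul, map_add] at hc
      have h₁ := ih k
      have h₂ := ih (k + 1)
      rw [Nat.stirlingSecond_succ_succ]
      rw [Nat.factorial_succ] at h₂
      rw [Nat.factorial_succ, Nat.factorial_succ]
      push_cast at *
      linear_combination (n ! : ℚ) * hc + ((k : ℚ) + 1) * h₁ + ((k : ℚ) + 1) * h₂

/-- The coefficients of `((e^t - 1) / t)^k` in terms of Stirling numbers. -/
theorem factorial_mul_coeff_expSubOneDiv_pow (j k : ℕ) :
    ((j + k)! : ℚ) * PowerSeries.coeff j (expSubOneDiv ^ k) =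
      (k ! : ℚ) * ((j + k).stirlingSecond k : ℚ) := by
  rw [← factorial_mul_coeff_exp_sub_one_pow, ← X_mul_expSubOneDiv, mul_pow,
    PowerSeries.coeff_X_pow_mul]

theorem val_tDivExpSubOne_zpow_neg (k : ℕ) :
    ((tDivExpSubOne ^ (-(k : ℤ)) : (PowerSeries ℚ)ˣ) : PowerSeries ℚ) = expSubOneDiv ^ k := by
  rw [zpow_neg, zpow_natCast, ← inv_pow, Units.val_pow_eq_pow_val]
  rfl

/-- The coefficient of `x^i` in `B_m^{(l)}(x)`. -/
theorem coeff_bernoulliPoly (l : ℤ) (m i : ℕ) :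
    (bernoulliPoly l m).coeff i = if i ≤ m then (m ! : ℚ) / (i ! : ℚ) *
      PowerSeries.coeff (m - i) ((tDivExpSubOne ^ l : (PowerSeries ℚ)ˣ) : PowerSeries ℚ)
      else 0 := by
  have hterm : ∀ a b : ℕ, (PowerSeries.coeff a (PowerSeries.map (Polynomial.C : ℚ →+* _)
        ((tDivExpSubOne ^ l : (PowerSeries ℚ)ˣ) : PowerSeries ℚ)) *
      PowerSeries.coeff b (PowerSeries.rescale (Polynomial.X : Polynomial ℚ)
        (PowerSeries.exp (Polynomial ℚ)))).coeff i =
      if i = b then PowerSeries.coeff a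
        ((tDivExpSubOne ^ l : (PowerSeries ℚ)ˣ) : PowerSeries ℚ) * (1 / (b ! : ℚ)) else 0 := by
    intro a b
    rw [PowerSeries.coeff_map, PowerSeries.coeff_rescale, PowerSeries.coeff_exp,
      Polynomial.algebraMap_eq, Polynomial.coeff_C_mul, Polynomial.coeff_mul_C,
      Polynomial.coeff_X_pow]
    split_ifs <;> simp
  rw [bernoulliPoly, Polynomial.coeff_smul, PowerSeries.coeff_mul, Polynomial.finsetSum_coeff,
    -- Reflecting indexes the sum by the power of `x`, so only the term `b = i` survives.
    Finset.Nat.sum_antidiagonal_eq_sum_range_succ_mk, ← Finset.sum_range_reflect]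
  simp only [hterm, smul_eq_mul]
  rw [Finset.sum_congr rfl (g := fun b => if i = b then PowerSeries.coeff (m - b)
    ((tDivExpSubOne ^ l : (PowerSeries ℚ)ˣ) : PowerSeries ℚ) * (1 / (b ! : ℚ)) else 0)]
  · rw [Finset.sum_ite_eq]
    simp only [Finset.mem_range, Nat.lt_succ_iff]
    split_ifs
    · ring
    · simp
  · intro b hb
    have hb' : b ≤ m := Nat.lt_succ_iff.1 (Finset.mem_range.1 hb)
    have h₁ : m + 1 - 1 - b = m - b := by omega
    have h₂ : m - (m - b) = b := by omega
    simp only [h₁, h₂]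

/-- `(n choose k) B_{n-k}^{(-k)}(x)` has the coefficients `(n choose i) S(n-i,k)`. -/
theorem choose_mul_coeff_bernoulliPoly {n k : ℕ} (hkn : k ≤ n) (i : ℕ) :
    (n.choose k : ℚ) * (bernoulliPoly (-(k : ℤ)) (n - k)).coeff i =
      if i ≤ n - k then ((n.choose i * (n - i).stirlingSecond k : ℕ) : ℚ) else 0 := by
  rw [coeff_bernoulliPoly, val_tDivExpSubOne_zpow_neg]
  split_ifs with hi
  -- This removes truncated subtraction; the factorials then cancel down to `hs`.
  · obtain ⟨j, rfl⟩ : ∃ j, n = j + k + i := ⟨n - k - i, by omega⟩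
    have h₁ : j + k + i - k = j + i := by omega
    have h₂ : j + i - i = j := by omega
    have h₃ : j + k + i - i = j + k := by omega
    rw [h₁, h₂, h₃, Nat.cast_mul, Nat.cast_choose ℚ (show k ≤ j + k + i by omega),
      Nat.cast_choose ℚ (show i ≤ j + k + i by omega), h₁, h₃]
    have hs := factorial_mul_coeff_expSubOneDiv_pow j k
    have f₁ : (k ! : ℚ) ≠ 0 := by positivity
    have f₂ : (i ! : ℚ) ≠ 0 := by positivity
    have f₃ : ((j + i)! : ℚ) ≠ 0 := by positivity
    have f₄ : ((j + k)! : ℚ) ≠ 0 := by positivity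
    field_simp
    linear_combination hs
  · simp

/-- If `d • f` has integer coefficients then the maximum pole of `f` at `p` is at most `ν_p(d)`. -/
theorem maxPole_le_of_forall_mul_coeff {p : ℕ} [Fact p.Prime] {f : Polynomial ℚ} {d : ℕ}
    (hd : d ≠ 0) (hf : ∀ i, ∃ z : ℤ, (d : ℚ) * f.coeff i = z) :
    maxPole p f ≤ padicValNat p d := by
  refine Finset.sup_le fun i _ => ?_
  obtain ⟨z, hz⟩ := hf i
  have hdvd : (f.coeff i).den ∣ d := by
    have h : f.coeff i = Rat.divInt z d := by
      rw [Rat.divInt_eq_div, eq_div_iff (by exact_mod_cast hd), mul_comm,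
        Int.cast_natCast, hz]
    rw [h]
    exact_mod_cast Rat.den_dvd z d
  exact (padicValNat_dvd_iff_le hd).1 (pow_padicValNat_dvd.trans hdvd)

theorem maxPole_bernoulliPoly_le {p : ℕ} [Fact p.Prime] {n k : ℕ} (hkn : k ≤ n) :
    maxPole p (bernoulliPoly (-(k : ℤ)) (n - k)) ≤ padicValNat p (n.choose k) := by
  refine maxPole_le_of_forall_mul_coeff (Nat.choose_pos hkn).ne' fun i => ?_
  rw [choose_mul_coeff_bernoulliPoly hkn]
  split_ifs
  · exact ⟨((n.choose i * (n - i).stirlingSecond k : ℕ) : ℤ), (Int.cast_natCast _).symm⟩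
  · exact ⟨0, Int.cast_zero.symm⟩

end HigherBernoulli

theorem mainTheorem12 (p : ℕ) (hp : p.Prime) (n k : ℕ) (hkn : k ≤ n) :
    0 ≤ HigherBernoulli.amzEstimate p n k ∧
      (1 ≤ k → 0 ≤ HigherBernoulli.samzEstimate p n k) := by
  have : Fact p.Prime := ⟨hp⟩
  refine ⟨sub_nonneg.2 (Nat.cast_le.2 (HigherBernoulli.maxPole_bernoulliPoly_le hkn)),
    fun hk => sub_nonneg.2 (Nat.cast_le.2 ?_)⟩
  -- Part (b) is the bound of part (a) at `(n - 1, k - 1)`.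
  have h := HigherBernoulli.maxPole_bernoulliPoly_le (p := p) (Nat.sub_le_sub_right hkn 1)
  have h₁ : -((k - 1 : ℕ) : ℤ) = -(k : ℤ) + 1 := by omega
  have h₂ : n - 1 - (k - 1) = n - k := by omega
  rwa [h₁, h₂] at h
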